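/- Let $M$ be a smooth ($C^\infty$) Hausdorff manifold of dimension $n\ge 2$ with a smooth affine connection $\nabla$, with connection coefficients $\Gamma^\mu_{\nu\sigma}$ in a chart, and let $\exp$ be its exponential map. A geodesic is a smooth curve $X\colon I\to M$ on an open interval with $\dot X\neq 0$ everywhere that satisfies $\ddot X^\mu+\Gamma^\mu_{\nu\sigma}(X)\dot X^\nu\dot X^\sigma=0$ in every chart. Fermi coordinates along a geodesic $X\colon I\to M$ with initial hyperplane $\Pi\subset T_{X(s_0)}M$, where $s_0\in I$ and $T_{X(s_0)}M=\operatorname{span}\{\dot X(s_0)\}\oplus\Pi$, are given by parallel vector fields $e_1,\dots,e_{n-1}$ along $X$ such that $e_1(s_0),\dots,e_{n-1}(s_0)$ is a basis of $\Pi$, and by an open neighbourhood $B\subset\mathbb R^{n-1}$ of $0$ such that $$f(s,z^1,\dots,z^{n-1})=\exp\Big(\sum_{i=1}^{n-1}z^ie_i(s)\Big)$$ is defined on $I\times B$ and is a diffeomorphism from $I\times B$ onto an open set $U\subset M$; the coordinates on $U$ are $x=(x^0,\dots,x^{n-1})=(s,z^1,\dots,z^{n-1})=f^{-1}$. For a geodesic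 $Y\colon K\to U$ in a chart $(U,x^\mu)$ and functions $\xi^\mu\colon K\to\mathbb R$ of class $C^2$, put $$G_U^\mu[\xi]=\ddot\xi^\mu+\Gamma^\mu_{\nu\sigma}\,(2\dot\xi^\nu\dot Y^\sigma+\dot\xi^\nu\dot\xi^\sigma)+\frac{\partial\Gamma^\mu_{\nu\sigma}}{\partial x^\alpha}\,\xi^\alpha(\dot Y^\nu+\dot\xi^\nu)(\dot Y^\sigma+\dot\xi^\sigma),$$ with $\Gamma^\mu_{\nu\sigma}$ and its derivatives evaluated at $Y$; $\xi$ is a generalized Jacobi field along $Y$ in the chart $U$ if $G_U^\mu[\xi]=0$ for all $\mu$. **Proposition.** Let $X\colon I\to M$ and $\widetilde X\colon\widetilde I\to M$ be geodesics that differ by a reparametrization, that is, $X=\widetilde X\circ\psi$ for a diffeomorphism $\psi\colon I\to\widetilde I$. Let $x=(s,z^1,\dots,z^{n-1})$ on $U$ and $\widetilde x=(\widetilde s,\widetilde z^1,\dots,\widetilde z^{n-1})$ on $\widetilde U$ be Fermi coordinates along $X$ and $\widetilde X$ with the same initial hyperplane $\Pi$ (in particular $X(s_0)=\widetilde X(\widetilde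 s_0)$). Then $X(I)\subset U\cap\widetilde U$, and $X(I)$ is contained in one connected component $W$ of $U\cap\widetilde U$. There are constants $A\neq 0$ and $B_0$ and an invertible matrix $T=(T^\mu_\nu)_{\mu,\nu=1}^{n-1}$ such that, with $L(s,z)=(As+B_0,\,Tz)$: 1. $\widetilde x=L(x)$ on $W$, that is, $\widetilde s=As+B_0$ and $\widetilde z^\mu=\sum_{\nu=1}^{n-1}T^\mu_\nu z^\nu$ for $\mu=1,\dots,n-1$. 2. More generally, the set $R$ of all $q\in U$ with $L(x(q))\in\widetilde x(\widetilde U)$ is contained in $U\cap\widetilde U$, and $\widetilde x=L(x)$ on $R$. (By 1, $W\subset R$.) 3. The generalized Jacobi equation is tensorial under this coordinate change: if $Y\colon K\to M$ is a geodesic with $Y(K)\subset R$ and $\widetilde\xi^\mu=\frac{\partial\widetilde x^\mu}{\partial x^\nu}\Big|_{Y}\xi^\nu$, then $G^\mu_{\widetilde U}[\widetilde\xi]=\frac{\partial\widetilde x^\mu}{\partial x^\nu}\Big|_{Y}\,G^\nu_U[\xi]$ for all $C^2$ functions $\xi^\mu\colon K\to\mathbb R$, and $\xi$ is a generalized Jacobi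 field along $Y$ in the chart $U$ if and only if $\widetilde\xi$ is one in the chart $\widetilde U$. -/

import Mathlib

open Set
open scoped Manifold ContDiff

noncomputable section

namespace GenJacobi

/-- The coordinate space `ℝⁿ`, `n = m + 1`, with coordinates indexed by `0, …, m`. -/
abbrev Coord (m : ℕ) : Type := EuclideanSpace ℝ (Fin (m + 1))

section Manifold

variable {m : ℕ} {M : Type*} [TopologicalSpace M] [ChartedSpace (Coord m) M]

/-- The coordinate vector field `w^σ ∂_σ` of the chart `e` with constant components `w`
(only its values on `e.source` are meaningful). -/
def coordField (e : OpenPartialHomeomorph M (Coord m)) (w : Coord m) (x : M) :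
    TangentSpace (𝓡 (m + 1)) x :=
  mfderiv (𝓡 (m + 1)) (𝓡 (m + 1)) e.symm (e x) w

/-- The components, in the chart `e`, of a tangent vector at `x`. -/
def tangentCoord (e : OpenPartialHomeomorph M (Coord m)) (x : M)
    (v : TangentSpace (𝓡 (m + 1)) x) : Coord m :=
  mfderiv (𝓡 (m + 1)) (𝓡 (m + 1)) e x v

/-- The tangent vector `Ẋ(s)` of a curve. -/
def velocity (X : ℝ → M) (s : ℝ) : TangentSpace (𝓡 (m + 1)) (X s) :=
  mfderiv 𝓘(ℝ, ℝ) (𝓡 (m + 1)) X s (1 : ℝ)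

variable [IsManifold (𝓡 (m + 1)) ∞ M]

variable (m M) in
/-- Affine connections on `M`: covariant derivatives on the tangent bundle. Smoothness is the
separate class `ContMDiffCovariantDerivative`. -/
abbrev AffineConnection :=
  CovariantDerivative (𝓡 (m + 1)) (Coord m) (TangentSpace (𝓡 (m + 1)) : M → Type _)

/-- The connection coefficients of `D` in the chart `e` at the coordinate point `y`, as the
bilinear expression `(v, w) ↦ (Γ^μ_{νσ}(y) v^ν w^σ)_μ`, i.e. the components of
`∇_{v^ν ∂_ν} (w^σ ∂_σ)` for constant `v` and `w`. -/
def christoffel (D : AffineConnection m M) (e : OpenPartialHomeomorph M (Coord m))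
    (y v w : Coord m) : Coord m :=
  tangentCoord e (e.symm y) (D (coordField e w) (e.symm y) (coordField e v (e.symm y)))

/-- Open intervals of the real line (nonempty, possibly unbounded). -/
structure IsOpenInterval (J : Set ℝ) : Prop where
  isOpen : IsOpen J
  ordConnected : J.OrdConnected
  nonempty : J.Nonempty

/-- `X` is smooth on the open set `J` and satisfies the geodesic equation
`Ẍ^μ + Γ^μ_{νσ}(X) Ẋ^ν Ẋ^σ = 0` there, in every chart of the smooth structure. Constant curves
are allowed. -/
structure SolvesGeodesicEq (D : AffineConnection m M) (J : Set ℝ) (X : ℝ → M) : Prop where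
  smooth : ContMDiffOn 𝓘(ℝ, ℝ) (𝓡 (m + 1)) ∞ X J
  eq : ∀ e ∈ IsManifold.maximalAtlas (𝓡 (m + 1)) ∞ M, ∀ s ∈ J, X s ∈ e.source →
    deriv (deriv (e ∘ X)) s
      + christoffel D e (e (X s)) (deriv (e ∘ X) s) (deriv (e ∘ X) s) = 0

/-- Affinely parametrized geodesics `X : J → M`, `J` an open interval; they are regular curves. -/
structure IsGeodesic (D : AffineConnection m M) (J : Set ℝ) (X : ℝ → M) : Prop where
  interval : IsOpenInterval J
  solves : SolvesGeodesicEq D J X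
  regular : ∀ s ∈ J, velocity (m := m) X s ≠ 0

/-- The vector field `V` along `X : J → M` is parallel:
`V̇^μ + Γ^μ_{νσ}(X) Ẋ^ν V^σ = 0` in every chart of the smooth structure. -/
def IsParallelAlong (D : AffineConnection m M) (J : Set ℝ) (X : ℝ → M)
    (V : ∀ s, TangentSpace (𝓡 (m + 1)) (X s)) : Prop :=
  ∀ e ∈ IsManifold.maximalAtlas (𝓡 (m + 1)) ∞ M, ∀ s ∈ J, X s ∈ e.source →
    HasDerivAt (fun t => tangentCoord e (X t) (V t))
      (-christoffel D e (e (X s)) (deriv (e ∘ X) s) (tangentCoord e (X s) (V s))) s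

/-- `q` is the time-one value of a solution of the geodesic equation with initial vector `u`. -/
def ExpReaches (D : AffineConnection m M) (u : TangentBundle (𝓡 (m + 1)) M) (q : M) : Prop :=
  ∃ (J : Set ℝ) (γ : ℝ → M), IsOpenInterval J ∧ (0 : ℝ) ∈ J ∧ (1 : ℝ) ∈ J ∧
    SolvesGeodesicEq D J γ ∧
    (⟨γ 0, velocity γ 0⟩ : TangentBundle (𝓡 (m + 1)) M) = u ∧ γ 1 = q

/-- The domain of the exponential map. -/
def expDomain (D : AffineConnection m M) : Set (TangentBundle (𝓡 (m + 1)) M) :=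
  {u | ∃ q, ExpReaches D u q}

open Classical in
/-- The exponential map of the connection, with an irrelevant value off `expDomain D`. (On a
Hausdorff manifold with smooth connection the point `q` with `ExpReaches D u q` is unique.) -/
def exp (D : AffineConnection m M) (u : TangentBundle (𝓡 (m + 1)) M) : M :=
  if h : ∃ q, ExpReaches D u q then h.choose else u.proj

/-- Fermi coordinates `(s, z¹, …, zᵐ)` along a curve `X : J → M` (in use, a geodesic). -/
structure FermiCoordinates (D : AffineConnection m M) (J : Set ℝ) (X : ℝ → M) where
  /-- the initial parameter value -/
  s₀ : ℝ
  s₀_mem : s₀ ∈ J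
  /-- the frame `e₁(s), …, eₘ(s)` along `X` -/
  frame : Fin m → ∀ s, TangentSpace (𝓡 (m + 1)) (X s)
  parallel : ∀ i, IsParallelAlong D J X (frame i)
  linearIndependent : LinearIndependent ℝ (fun i => frame i s₀)
  isCompl : IsCompl (Submodule.span ℝ {velocity X s₀})
    (Submodule.span ℝ (range fun i => frame i s₀))
  /-- the neighbourhood `B` of the origin over which `z = (z¹, …, zᵐ)` ranges -/
  B : Set (Fin m → ℝ)
  isOpen_B : IsOpen B
  zero_mem_B : 0 ∈ B
  /-- the coordinate chart `(s, z¹, …, zᵐ)`, the inverse of the diffeomorphism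
  `f (s, z) = exp (∑ i, zⁱ eᵢ(s))` from `J × B` onto its range -/
  chart : OpenPartialHomeomorph M (Coord m)
  chart_mem : chart ∈ IsManifold.maximalAtlas (𝓡 (m + 1)) ∞ M
  target_eq : chart.target = {x | x 0 ∈ J ∧ (fun i : Fin m => x i.succ) ∈ B}
  mem_expDomain : ∀ x ∈ chart.target,
    (⟨X (x 0), ∑ i : Fin m, x i.succ • frame i (x 0)⟩ : TangentBundle (𝓡 (m + 1)) M)
      ∈ expDomain D
  symm_eq : ∀ x ∈ chart.target,
    chart.symm x = exp D ⟨X (x 0), ∑ i : Fin m, x i.succ • frame i (x 0)⟩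

/-- The initial hyperplane `Π = span {e₁(s₀), …, eₘ(s₀)}` in `T_{X(s₀)} M`, as a subset of the
tangent bundle (so that it remembers its base point). -/
def FermiCoordinates.hyperplane {D : AffineConnection m M} {J : Set ℝ} {X : ℝ → M}
    (F : FermiCoordinates D J X) : Set (TangentBundle (𝓡 (m + 1)) M) :=
  (fun v : TangentSpace (𝓡 (m + 1)) (X F.s₀) =>
      (⟨X F.s₀, v⟩ : TangentBundle (𝓡 (m + 1)) M)) ''
    (Submodule.span ℝ (range fun i => F.frame i F.s₀) :
      Set (TangentSpace (𝓡 (m + 1)) (X F.s₀)))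

/-- The expression
`G^μ[ξ] = ξ̈^μ + Γ^μ_{νσ} (2 ξ̇^ν Ẏ^σ + ξ̇^ν ξ̇^σ) + ∂_α Γ^μ_{νσ} ξ^α (Ẏ^ν + ξ̇^ν) (Ẏ^σ + ξ̇^σ)`
in the chart `e` along the curve `Y`, with `Γ` and its derivatives evaluated at `Y(s)`. -/
def genJacobiOp (D : AffineConnection m M) (e : OpenPartialHomeomorph M (Coord m))
    (Y : ℝ → M) (ξ : ℝ → Coord m) (s : ℝ) : Coord m :=
  deriv (deriv ξ) s
    + ((2 : ℝ) • christoffel D e (e (Y s)) (deriv ξ s) (deriv (e ∘ Y) s)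
        + christoffel D e (e (Y s)) (deriv ξ s) (deriv ξ s))
    + fderiv ℝ
        (fun x => christoffel D e x (deriv (e ∘ Y) s + deriv ξ s) (deriv (e ∘ Y) s + deriv ξ s))
        (e (Y s)) (ξ s)

/-- The functions `ξ^μ` define a generalized Jacobi field along `Y : K → M` in the chart `e`. -/
structure IsGenJacobiField (D : AffineConnection m M) (e : OpenPartialHomeomorph M (Coord m))
    (K : Set ℝ) (Y : ℝ → M) (ξ : ℝ → Coord m) : Prop where
  contDiffOn : ContDiffOn ℝ 2 ξ K
  eq_zero : ∀ s ∈ K, genJacobiOp D e Y ξ s = 0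

end Manifold

/-- `X : J → M` and `X' : J' → M` differ by a reparametrization: `X = X' ∘ ψ` for a
diffeomorphism `ψ : J → J'`. -/
def IsReparametrization {M : Type*} (J : Set ℝ) (X : ℝ → M) (J' : Set ℝ) (X' : ℝ → M) : Prop :=
  ∃ ψ : ℝ → ℝ, ContDiffOn ℝ ∞ ψ J ∧ (∀ s ∈ J, deriv ψ s ≠ 0) ∧ BijOn ψ J J' ∧
    ∀ s ∈ J, X s = X' (ψ s)

/-- The affine map `(s, z) ↦ (A s + B, T z)` of coordinate space. -/
def fermiAffine {m : ℕ} (A B : ℝ) (T : Matrix (Fin m) (Fin m) ℝ) (x : Coord m) : Coord m :=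
  WithLp.toLp 2 (Fin.cons (A * x 0 + B) (fun i => ∑ j, T i j * x j.succ))

end GenJacobi

end

/-!
In a chart, parallelism along a curve is a linear ODE, so parallel fields are determined by one
value. The velocity of a geodesic is parallel along it, so a geodesic whose velocity vanishes at a
point is constant, whence `exp 0 = p` at every `p` and the axis `z = 0` of Fermi coordinates along
`X` is `X` itself. As this axis solves the geodesic equation, `Γ^μ_{00} = 0` on it, and a geodesic
with the same image is read off in these coordinates as `s ↦ (φ s, 0)` with `φ̈ = 0`: the change of
parameter is affine. Parallel frames that span the same hyperplane at one point differ by a constant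
matrix `T`, so `f = f' ∘ L` for the two parametrizations `f (s, z) = exp (∑ i, zⁱ eᵢ(s))` and
`L (s, z) = (A s + B, T z)`. Finally, `L` is affine, so the inhomogeneous second derivative term in
the change of the connection coefficients vanishes: `Γ`, its derivatives and the generalized Jacobi
expression transform by the constant matrix of `L`.

The relation `x' = L x` holds on an open set; it extends to the component `W` because that set is
also relatively closed in the common domain, by continuity of both coordinate maps.
-/

namespace GenJacobi

open Filter Topology Bundle Matrix

section LinearODE

variable {E : Type*} [NormedAddCommGroup E] [NormedSpace ℝ E]

lemma eventually_eq_iff_eq_of_linear_ode {G : ℝ → E →L[ℝ] E} {f g : ℝ → E} {t : ℝ}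
    (hG : (𝓝 t).IsBoundedUnder (· ≤ ·) fun s => ‖G s‖)
    (hf : ∀ᶠ s in 𝓝 t, HasDerivAt f (G s (f s)) s)
    (hg : ∀ᶠ s in 𝓝 t, HasDerivAt g (G s (g s)) s) :
    ∀ᶠ s in 𝓝 t, (f t = g t ↔ f s = g s) := by
  obtain ⟨C, hC⟩ := hG
  obtain ⟨ε, hε, hball⟩ := Metric.eventually_nhds_iff_ball.1
    ((eventually_map.1 hC).and (hf.and hg))
  have ht := Metric.mem_ball_self (x := t) hε
  have hnhds := Metric.ball_mem_nhds t hε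
  rw [Real.ball_eq_Ioo] at hball ht hnhds
  have hunique : ∀ s ∈ Ioo (t - ε) (t + ε), f s = g s → EqOn f g (Ioo (t - ε) (t + ε)) :=
    fun s hs => ODE_solution_unique_of_mem_Ioo (v := fun r => G r) (s := fun _ => univ)
      (K := C.toNNReal)
      (fun r hr => ((G r).lipschitz.weaken
        (NNReal.le_toNNReal_of_coe_le (hball r hr).1)).lipschitzOnWith) hs
      (fun r hr => ⟨(hball r hr).2.1, mem_univ _⟩) (fun r hr => ⟨(hball r hr).2.2, mem_univ _⟩)
  filter_upwards [hnhds] with s hs using ⟨fun h => hunique t ht h hs, fun h => hunique s hs h ht⟩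

lemma exists_eq_smul_add_of_deriv_deriv_eq_zero {u : ℝ → E} {K : Set ℝ} (hK : IsOpen K)
    (hK' : IsPreconnected K) (hu : DifferentiableOn ℝ u K) (hu' : DifferentiableOn ℝ (deriv u) K)
    (hu'' : EqOn (deriv (deriv u)) 0 K) : ∃ a b : E, ∀ s ∈ K, u s = s • a + b := by
  obtain ⟨a, ha⟩ := hK.exists_is_const_of_deriv_eq_zero hK' hu' hu''
  have hline : ∀ s : ℝ, HasDerivAt (fun r => r • a) a s := fun s => by
    simpa using (hasDerivAt_id s).smul_const a
  obtain ⟨b, hb⟩ := hK.exists_eq_add_of_deriv_eq hK' hu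
    (fun s _ => (hline s).differentiableAt.differentiableWithinAt)
    fun s hs => (ha s hs).trans (hline s).deriv.symm
  exact ⟨a, b, hb⟩

end LinearODE

section Frames

variable {R ι κ : Type*} [CommRing R] [Fintype ι] [Fintype κ]

lemma exists_matrix_sum_smul_eq_of_mem_span {V : Type*} [AddCommGroup V] [Module R V]
    {v : ι → V} {v' : κ → V} (h : ∀ i, v i ∈ Submodule.span R (range v')) :
    ∃ T : Matrix κ ι R, ∀ z : ι → R, ∑ i, z i • v i = ∑ j, (T *ᵥ z) j • v' j := by
  choose c hc using fun i => (Submodule.mem_span_range_iff_exists_fun R).1 (h i)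
  refine ⟨.of fun j i => c i j, fun z => ?_⟩
  simp only [← hc, Finset.smul_sum, smul_smul, mulVec, dotProduct, of_apply, Finset.sum_smul]
  rw [Finset.sum_comm]
  simp only [mul_comm]

lemma exists_isUnit_matrix_sum_smul_eq_of_span_eq [DecidableEq ι] {V : Type*} [AddCommGroup V]
    [Module R V] {v v' : ι → V} (hv : LinearIndependent R v)
    (h : Submodule.span R (range v) = Submodule.span R (range v')) :
    ∃ T : Matrix ι ι R, IsUnit T ∧ ∀ z : ι → R, ∑ i, z i • v i = ∑ j, (T *ᵥ z) j • v' j := by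
  obtain ⟨T, hT⟩ := exists_matrix_sum_smul_eq_of_mem_span (v := v) (v' := v') fun i =>
    h ▸ Submodule.subset_span (mem_range_self i)
  obtain ⟨S, hS⟩ := exists_matrix_sum_smul_eq_of_mem_span (v := v') (v' := v) fun i =>
    h.symm ▸ Submodule.subset_span (mem_range_self i)
  have hST : S * T = 1 := Matrix.ext_of_mulVec_single fun i =>
    hv.fintypeLinearCombination_injective <| by
      rw [Fintype.linearCombination_apply, Fintype.linearCombination_apply, ← mulVec_mulVec,
        ← hS, ← hT, one_mulVec]
  exact ⟨T, IsUnit.of_mul_eq_one_right S hST, hT⟩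

lemma exists_isUnit_matrix_mk_sum_smul_eq [DecidableEq ι] {B F : Type*} {E : B → Type*}
    [∀ x, AddCommGroup (E x)] [∀ x, Module R (E x)] {x x' : B} {v : ι → E x} {v' : ι → E x'}
    (hv : LinearIndependent R v)
    (h : TotalSpace.mk' F x '' (Submodule.span R (range v) : Set (E x)) =
      TotalSpace.mk' F x' '' (Submodule.span R (range v') : Set (E x'))) :
    ∃ T : Matrix ι ι R, IsUnit T ∧ ∀ z : ι → R, (⟨x, ∑ i, z i • v i⟩ : TotalSpace F E) =
      ⟨x', ∑ j, (T *ᵥ z) j • v' j⟩ := by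
  have hx : x = x' := by
    obtain ⟨w, -, hw⟩ := h.subset (mem_image_of_mem _ (Submodule.zero_mem _))
    exact (congrArg TotalSpace.proj hw).symm
  subst hx
  obtain ⟨T, hT, hsum⟩ := exists_isUnit_matrix_sum_smul_eq_of_span_eq hv
    (SetLike.coe_injective ((TotalSpace.mk_injective x).image_injective h))
  exact ⟨T, hT, fun z => congrArg (TotalSpace.mk' F x) (hsum z)⟩

end Frames

section TransitionRegion

variable {M H H' : Type*} [TopologicalSpace M] [TopologicalSpace H] [TopologicalSpace H']
  {e : OpenPartialHomeomorph M H} {e' : OpenPartialHomeomorph M H'} {L : H → H'}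

/-- The points of the domain of `e` at which `L ∘ e` is a possible value of the chart `e'`.
This is the set `R` of the paper. -/
def transitionRegion (e : OpenPartialHomeomorph M H) (e' : OpenPartialHomeomorph M H')
    (L : H → H') : Set M :=
  e.source ∩ e ⁻¹' (L ⁻¹' e'.target)

lemma isOpen_transitionRegion (hL : Continuous L) : IsOpen (transitionRegion e e' L) :=
  e.isOpen_inter_preimage (e'.open_target.preimage hL)

lemma mem_source_and_apply_eq_of_mem_transitionRegion
    (h : ∀ x ∈ e.target, L x ∈ e'.target → e.symm x = e'.symm (L x)) {q : M}
    (hq : q ∈ transitionRegion e e' L) : q ∈ e'.source ∧ e' q = L (e q) := by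
  have hsymm : q = e'.symm (L (e q)) := by
    rw [← h _ (e.map_source hq.1) hq.2, e.left_inv hq.1]
  exact ⟨hsymm ▸ e'.map_target hq.2, (congrArg e' hsymm).trans (e'.right_inv hq.2)⟩

lemma subset_transitionRegion_of_isPreconnected [T2Space H'] (hL : Continuous L)
    (h : ∀ x ∈ e.target, L x ∈ e'.target → e.symm x = e'.symm (L x)) {W : Set M}
    (hW : IsPreconnected W) (hWe : W ⊆ e.source ∩ e'.source)
    (hne : (W ∩ transitionRegion e e' L).Nonempty) : W ⊆ transitionRegion e e' L := by
  refine hW.subset_of_closure_inter_subset (isOpen_transitionRegion hL) hne ?_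
  rintro q ⟨hqR, hqW⟩
  obtain ⟨hqe, hqe'⟩ := hWe hqW
  have : (𝓝[transitionRegion e e' L] q).NeBot := mem_closure_iff_nhdsWithin_neBot.1 hqR
  have hlim : e' q = L (e q) := by
    refine tendsto_nhds_unique_of_eventuallyEq (l := 𝓝[transitionRegion e e' L] q)
      (e'.continuousAt hqe').continuousWithinAt
      (hL.continuousAt.comp (e.continuousAt hqe)).continuousWithinAt ?_
    filter_upwards [self_mem_nhdsWithin] with z hz
      using (mem_source_and_apply_eq_of_mem_transitionRegion h hz).2
  exact ⟨hqe, show L (e q) ∈ e'.target from hlim ▸ e'.map_source hqe'⟩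

end TransitionRegion

section CovariantDerivative

variable {E H M F : Type*} [NormedAddCommGroup E] [NormedSpace ℝ E] [FiniteDimensional ℝ E]
  [TopologicalSpace H] {I : ModelWithCorners ℝ E H} [TopologicalSpace M] [T2Space M]
  [ChartedSpace H M] [IsManifold I ∞ M] [NormedAddCommGroup F] [NormedSpace ℝ F]
  {V : M → Type*} [TopologicalSpace (TotalSpace F V)] [∀ x, AddCommGroup (V x)]
  [∀ x, Module ℝ (V x)] [∀ x, TopologicalSpace (V x)] [∀ x, IsTopologicalAddGroup (V x)]
  [∀ x, ContinuousSMul ℝ (V x)] [FiberBundle F V] [VectorBundle ℝ F V]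

lemma contMDiffOn_covariantDerivative {k : ℕ∞} [ContMDiffVectorBundle (k + 1) F V I]
    (cov : CovariantDerivative I F V) [cov.ContMDiffCovariantDerivative k] {U : Set M}
    (hU : IsOpen U) {σ : ∀ x, V x}
    (hσ : ContMDiffOn I (I.prod 𝓘(ℝ, F)) (k + 1) (fun x => (⟨x, σ x⟩ : TotalSpace F V)) U) :
    ContMDiffOn I (I.prod 𝓘(ℝ, E →L[ℝ] F)) k
      (fun x => (⟨x, cov σ x⟩ :
        TotalSpace (E →L[ℝ] F) fun x => TangentSpace I x →L[ℝ] V x)) U := by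
  intro x hx
  obtain ⟨f, -, hf⟩ := (SmoothBumpFunction.nhds_basis_tsupport (I := I) x).mem_iff.1
    (hU.mem_nhds hx)
  have hfσ : ContMDiff I (I.prod 𝓘(ℝ, F)) (k + 1)
      (fun z => (⟨z, ((f : M → ℝ) • σ) z⟩ : TotalSpace F V)) :=
    ContMDiffOn.smul_section_of_tsupport
      (f.contMDiff.contMDiffOn.of_le (by exact_mod_cast le_top)) hU hf hσ
  have hglobal := (CovariantDerivative.ContMDiffCovariantDerivative.contMDiff
    (cov := cov) (k := k)).contMDiff hfσ.contMDiffOn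
  refine ((hglobal.contMDiffAt univ_mem).congr_of_eventuallyEq ?_).contMDiffWithinAt
  filter_upwards [f.eventuallyEq_one.eventuallyEq_nhds, hU.mem_nhds hx] with z hz hzU
  refine congrArg (TotalSpace.mk z) (cov.isCovariantDerivativeOnUniv.congr_of_eventuallyEq
    ((hσ.contMDiffAt (hU.mem_nhds hzU)).mdifferentiableAt (by simp))
    (hfσ.mdifferentiableAt (by simp)) univ_mem ?_)
  filter_upwards [hz] with y hy
  simp [hy]

end CovariantDerivative

section Charts

variable {m : ℕ} {M : Type*} [TopologicalSpace M] [ChartedSpace (Coord m) M]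
  {e : OpenPartialHomeomorph M (Coord m)}

lemma mdifferentiable_of_mem_maximalAtlas
    (he : e ∈ IsManifold.maximalAtlas (𝓡 (m + 1)) ∞ M) :
    e.MDifferentiable (𝓡 (m + 1)) (𝓡 (m + 1)) :=
  ⟨(contMDiffOn_of_mem_maximalAtlas he).mdifferentiableOn (by simp),
    (contMDiffOn_symm_of_mem_maximalAtlas he).mdifferentiableOn (by simp)⟩

section Linearity

variable (e : OpenPartialHomeomorph M (Coord m)) (x : M)

lemma tangentCoord_zero : tangentCoord e x 0 = 0 :=
  map_zero (mfderiv (𝓡 (m + 1)) (𝓡 (m + 1)) e x)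

lemma tangentCoord_add (v v' : TangentSpace (𝓡 (m + 1)) x) :
    tangentCoord e x (v + v') = tangentCoord e x v + tangentCoord e x v' :=
  map_add (mfderiv (𝓡 (m + 1)) (𝓡 (m + 1)) e x) v v'

lemma tangentCoord_smul (c : ℝ) (v : TangentSpace (𝓡 (m + 1)) x) :
    tangentCoord e x (c • v) = c • tangentCoord e x v :=
  map_smul (mfderiv (𝓡 (m + 1)) (𝓡 (m + 1)) e x) c v

lemma tangentCoord_sum_smul {ι : Type*} (s : Finset ι) (c : ι → ℝ)
    (v : ι → TangentSpace (𝓡 (m + 1)) x) :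
    tangentCoord e x (∑ i ∈ s, c i • v i) = ∑ i ∈ s, c i • tangentCoord e x (v i) :=
  (map_sum (mfderiv (𝓡 (m + 1)) (𝓡 (m + 1)) e x) (fun i => c i • v i) s).trans
    (Finset.sum_congr rfl fun i _ => tangentCoord_smul e x (c i) (v i))

lemma coordField_add (w w' : Coord m) :
    coordField (M := M) e (w + w') = coordField e w + coordField e w' :=
  funext fun x => map_add (mfderiv (𝓡 (m + 1)) (𝓡 (m + 1)) e.symm (e x)) w w'

lemma coordField_smul (c : ℝ) (w : Coord m) :
    coordField (M := M) e (c • w) = c • coordField e w :=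
  funext fun x => map_smul (mfderiv (𝓡 (m + 1)) (𝓡 (m + 1)) e.symm (e x)) c w

end Linearity

lemma tangentCoord_coordField (he : e ∈ IsManifold.maximalAtlas (𝓡 (m + 1)) ∞ M)
    (w : Coord m) {x : M} (hx : x ∈ e.source) : tangentCoord e x (coordField e w x) = w := by
  have h := (mdifferentiable_of_mem_maximalAtlas he).comp_symm_deriv (e.map_source hx)
  rw [e.left_inv hx] at h
  exact congrArg (fun f : Coord m →L[ℝ] Coord m => f w) h

lemma tangentCoord_injective (he : e ∈ IsManifold.maximalAtlas (𝓡 (m + 1)) ∞ M) {x : M}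
    (hx : x ∈ e.source) : Function.Injective (tangentCoord e x) :=
  Function.LeftInverse.injective
    (g := fun w => mfderiv (𝓡 (m + 1)) (𝓡 (m + 1)) e.symm (e x) w) fun v =>
    congrArg (fun f : Coord m →L[ℝ] Coord m => f v)
      ((mdifferentiable_of_mem_maximalAtlas he).symm_comp_deriv hx)

lemma tangentBundle_mk_eq_iff (he : e ∈ IsManifold.maximalAtlas (𝓡 (m + 1)) ∞ M) {x x' : M}
    (hx : x ∈ e.source) (hxx' : x = x') {v : TangentSpace (𝓡 (m + 1)) x}
    {v' : TangentSpace (𝓡 (m + 1)) x'} :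
    (⟨x, v⟩ : TangentBundle (𝓡 (m + 1)) M) = ⟨x', v'⟩ ↔
      tangentCoord e x v = tangentCoord e x' v' := by
  subst hxx'
  rw [(tangentCoord_injective he hx).eq_iff]
  exact (TotalSpace.mk_injective x).eq_iff

lemma hasDerivAt_chart_comp (he : e ∈ IsManifold.maximalAtlas (𝓡 (m + 1)) ∞ M) {γ : ℝ → M}
    {t : ℝ} (hγ : MDifferentiableAt 𝓘(ℝ, ℝ) (𝓡 (m + 1)) γ t) (ht : γ t ∈ e.source) :
    HasDerivAt (e ∘ γ) (tangentCoord e (γ t) (velocity γ t)) t := by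
  have hcomp := ((mdifferentiable_of_mem_maximalAtlas he).mdifferentiableAt ht).hasMFDerivAt.comp t
    hγ.hasMFDerivAt
  refine hcomp.mdifferentiableAt.differentiableAt.hasDerivAt.congr_deriv ?_
  rw [← fderiv_apply_one_eq_deriv, ← mfderiv_eq_fderiv, hcomp.mfderiv]
  rfl

lemma contDiffAt_chart_comp {n : ℕ∞} (he : e ∈ IsManifold.maximalAtlas (𝓡 (m + 1)) ∞ M)
    {γ : ℝ → M} {t : ℝ} (hγ : ContMDiffAt 𝓘(ℝ, ℝ) (𝓡 (m + 1)) n γ t) (ht : γ t ∈ e.source) :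
    ContDiffAt ℝ n (e ∘ γ) t :=
  contMDiffAt_iff_contDiffAt.1
    (((contMDiffAt_of_mem_maximalAtlas he ht).of_le (by exact_mod_cast le_top)).comp t hγ)

variable [IsManifold (𝓡 (m + 1)) ∞ M]

lemma contMDiffOn_coordField (he : e ∈ IsManifold.maximalAtlas (𝓡 (m + 1)) ∞ M) (w : Coord m) :
    ContMDiffOn (𝓡 (m + 1)) ((𝓡 (m + 1)).prod 𝓘(ℝ, Coord m)) ∞
      (fun x => (⟨x, coordField e w x⟩ : TangentBundle (𝓡 (m + 1)) M)) e.source := by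
  have hsymm := (contMDiffOn_symm_of_mem_maximalAtlas he).contMDiffOn_tangentMapWithin
    (m := ∞) (by simp) e.open_target.uniqueMDiffOn
  have hconst : ContMDiff (𝓡 (m + 1)) (𝓡 (m + 1)).tangent ∞
      (fun y : Coord m => (⟨y, w⟩ : TangentBundle (𝓡 (m + 1)) (Coord m))) := fun y => by
    refine (contMDiffAt_section (F := Coord m) (E := TangentSpace (𝓡 (m + 1)))
      (s := fun _ => w) y).2 ?_
    simpa using contMDiffAt_const
  refine (hsymm.comp (hconst.comp_contMDiffOn (contMDiffOn_of_mem_maximalAtlas he))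
    fun x hx => e.map_source hx).congr fun x hx => ?_
  have hy := e.map_source hx
  have hmap : tangentMapWithin (𝓡 (m + 1)) (𝓡 (m + 1)) e.symm e.target
      (⟨e x, w⟩ : TangentBundle (𝓡 (m + 1)) (Coord m)) = ⟨x, coordField e w x⟩ := by
    rw [tangentMapWithin_eq_tangentMap (e.open_target.uniqueMDiffOn _ hy)
      ((mdifferentiable_of_mem_maximalAtlas he).mdifferentiableAt_symm hy)]
    exact TotalSpace.ext (e.left_inv hx) (by rfl)
  exact hmap.symm

lemma mdifferentiableAt_coordField (he : e ∈ IsManifold.maximalAtlas (𝓡 (m + 1)) ∞ M)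
    (w : Coord m) {x : M} (hx : x ∈ e.source) :
    MDifferentiableAt (𝓡 (m + 1)) ((𝓡 (m + 1)).prod 𝓘(ℝ, Coord m))
      (fun x => (⟨x, coordField e w x⟩ : TangentBundle (𝓡 (m + 1)) M)) x :=
  ((contMDiffOn_coordField he w).contMDiffAt (e.open_source.mem_nhds hx)).mdifferentiableAt
    (by simp)

lemma contMDiffOn_tangentCoord (he : e ∈ IsManifold.maximalAtlas (𝓡 (m + 1)) ∞ M) :
    ContMDiffOn (𝓡 (m + 1)).tangent 𝓘(ℝ, Coord m) ∞
      (fun p : TangentBundle (𝓡 (m + 1)) M => tangentCoord e p.1 p.2)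
      (TotalSpace.proj ⁻¹' e.source) := by
  have hmap := (contMDiffOn_of_mem_maximalAtlas he).contMDiffOn_tangentMapWithin
    (m := ∞) (by simp) e.open_source.uniqueMDiffOn
  have hsnd := contMDiff_snd_tangentBundle_modelSpace (n := ∞) (Coord m) (𝓡 (m + 1))
  refine (hsnd.comp_contMDiffOn hmap).congr fun p hp => ?_
  exact congrArg (fun f : Coord m →L[ℝ] Coord m => f p.2)
    (mfderivWithin_of_isOpen e.open_source hp).symm

end Charts

section Christoffel

variable {m : ℕ} {M : Type*} [TopologicalSpace M] [ChartedSpace (Coord m) M]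
  [IsManifold (𝓡 (m + 1)) ∞ M] (D : AffineConnection m M)
  {e : OpenPartialHomeomorph M (Coord m)}

lemma christoffel_add_left (e : OpenPartialHomeomorph M (Coord m)) (y v v' w : Coord m) :
    christoffel D e y (v + v') w = christoffel D e y v w + christoffel D e y v' w := by
  simp only [christoffel, coordField_add, Pi.add_apply, map_add, tangentCoord_add]

lemma christoffel_smul_left (e : OpenPartialHomeomorph M (Coord m)) (y : Coord m) (c : ℝ)
    (v w : Coord m) : christoffel D e y (c • v) w = c • christoffel D e y v w := by
  simp only [christoffel, coordField_smul, Pi.smul_apply, map_smul, tangentCoord_smul]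

lemma christoffel_add_right (he : e ∈ IsManifold.maximalAtlas (𝓡 (m + 1)) ∞ M) {y : Coord m}
    (hy : y ∈ e.target) (v w w' : Coord m) :
    christoffel D e y v (w + w') = christoffel D e y v w + christoffel D e y v w' := by
  have hx := e.map_target hy
  unfold christoffel
  rw [coordField_add, D.isCovariantDerivativeOnUniv.add (mdifferentiableAt_coordField he w hx)
    (mdifferentiableAt_coordField he w' hx), _root_.add_apply, tangentCoord_add]

lemma christoffel_smul_right (he : e ∈ IsManifold.maximalAtlas (𝓡 (m + 1)) ∞ M) {y : Coord m}
    (hy : y ∈ e.target) (c : ℝ) (v w : Coord m) :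
    christoffel D e y v (c • w) = c • christoffel D e y v w := by
  unfold christoffel
  rw [coordField_smul, D.isCovariantDerivativeOnUniv.smul_const c
    (mdifferentiableAt_coordField he w (e.map_target hy)), _root_.smul_apply, tangentCoord_smul]

lemma contDiffOn_christoffel [T2Space M] {k : ℕ∞}
    [CovariantDerivative.ContMDiffCovariantDerivative D k]
    (he : e ∈ IsManifold.maximalAtlas (𝓡 (m + 1)) ∞ M) (v w : Coord m) :
    ContDiffOn ℝ k (fun y => christoffel D e y v w) e.target := by
  have : ContMDiffVectorBundle (k + 1) (Coord m) (TangentSpace (𝓡 (m + 1)) : M → Type _)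
      (𝓡 (m + 1)) := .of_le (n := ∞) (by exact_mod_cast le_top)
  have hw := (contMDiffOn_coordField he w).of_le (m := k + 1) (by exact_mod_cast le_top)
  have hv := (contMDiffOn_coordField he v).of_le (m := k) (by exact_mod_cast le_top)
  have hD := (contMDiffOn_covariantDerivative D e.open_source hw).clm_bundle_apply hv
  have htc := (contMDiffOn_tangentCoord he).of_le (m := k) (by exact_mod_cast le_top)
  have hsymm := (contMDiffOn_symm_of_mem_maximalAtlas he).of_le (m := k)
    (by exact_mod_cast le_top)
  exact contMDiffOn_iff_contDiffOn.1
    ((htc.comp hD fun x hx => hx).comp hsymm fun y hy => e.map_target hy)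

/-- The connection coefficients are continuous functions in every chart of the smooth structure:
the only regularity of the connection that uniqueness of parallel transport needs. -/
def HasContinuousCoefficients : Prop :=
  ∀ e ∈ IsManifold.maximalAtlas (𝓡 (m + 1)) ∞ M, ∀ v w : Coord m,
    ContinuousOn (fun y => christoffel D e y v w) e.target

lemma hasContinuousCoefficients [T2Space M] (k : ℕ∞)
    [CovariantDerivative.ContMDiffCovariantDerivative D k] : HasContinuousCoefficients D :=
  fun _ he v w => (contDiffOn_christoffel (k := k) D he v w).continuousOn

open Classical in
/-- The connection coefficients at `y` as a bilinear map `(v, w) ↦ Γ(y)(v, w)`. Bilinearity needs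
`e` to be a chart of the smooth structure and `y` a point of its target; elsewhere the value
is `0`. -/
noncomputable def christoffelCLM (e : OpenPartialHomeomorph M (Coord m)) (y : Coord m) :
    Coord m →L[ℝ] Coord m →L[ℝ] Coord m :=
  if h : e ∈ IsManifold.maximalAtlas (𝓡 (m + 1)) ∞ M ∧ y ∈ e.target then
    (LinearMap.mk₂ ℝ (christoffel D e y) (christoffel_add_left D e y)
      (christoffel_smul_left D e y) (christoffel_add_right D h.1 h.2)
      (christoffel_smul_right D h.1 h.2)).toContinuousBilinearMap
  else 0

lemma christoffelCLM_apply (he : e ∈ IsManifold.maximalAtlas (𝓡 (m + 1)) ∞ M) {y : Coord m}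
    (hy : y ∈ e.target) (v w : Coord m) :
    christoffelCLM D e y v w = christoffel D e y v w := by
  simp only [christoffelCLM, dif_pos (And.intro he hy)]
  rfl

variable {D}

lemma HasContinuousCoefficients.continuousOn_christoffelCLM (hD : HasContinuousCoefficients D)
    (he : e ∈ IsManifold.maximalAtlas (𝓡 (m + 1)) ∞ M) :
    ContinuousOn (christoffelCLM D e) e.target :=
  continuousOn_clm_apply.2 fun v => continuousOn_clm_apply.2 fun w =>
    (hD e he v w).congr fun _ hy => christoffelCLM_apply D he hy v w

end Christoffel

section ParallelFields

variable {m : ℕ} {M : Type*} [TopologicalSpace M] [ChartedSpace (Coord m) M]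
  [IsManifold (𝓡 (m + 1)) ∞ M] {D : AffineConnection m M} {J J' : Set ℝ} {X Y : ℝ → M}
  {V : ∀ s, TangentSpace (𝓡 (m + 1)) (X s)} {W : ∀ s, TangentSpace (𝓡 (m + 1)) (Y s)}

lemma IsParallelAlong.sum_smul {ι : Type*} {V : ι → ∀ s, TangentSpace (𝓡 (m + 1)) (X s)}
    (hV : ∀ i, IsParallelAlong D J X (V i)) (S : Finset ι) (c : ι → ℝ) :
    IsParallelAlong D J X (fun s => ∑ i ∈ S, c i • V i s) := fun e he s hs hXs => by
  simp only [tangentCoord_sum_smul, ← christoffelCLM_apply D he (e.map_source hXs), map_sum,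
    map_smul, ← Finset.sum_neg_distrib, ← smul_neg]
  refine HasDerivAt.fun_sum fun i _ => HasDerivAt.const_smul (c i) ?_
  rw [christoffelCLM_apply D he (e.map_source hXs)]
  exact hV i e he s hs hXs

lemma isParallelAlong_zero : IsParallelAlong D J X (fun _ => 0) := by
  simpa only [Finset.sum_empty] using
    IsParallelAlong.sum_smul (V := fun (_ : Empty) _ => 0) (D := D) (J := J) (X := X)
      (fun i => i.elim) ∅ fun _ => 0

lemma IsParallelAlong.comp (hV : IsParallelAlong D J X V)
    (hX : ∀ t ∈ J, MDifferentiableAt 𝓘(ℝ, ℝ) (𝓡 (m + 1)) X t) {φ : ℝ → ℝ}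
    (hφ : ∀ s ∈ J', DifferentiableAt ℝ φ s) (hφJ : MapsTo φ J' J) :
    IsParallelAlong D J' (X ∘ φ) (fun s => V (φ s)) := fun e he s hs hXs => by
  have hderiv : deriv (e ∘ X ∘ φ) s = deriv φ s • deriv (e ∘ X) (φ s) :=
    deriv.scomp s (hasDerivAt_chart_comp he (hX _ (hφJ hs)) hXs).differentiableAt (hφ s hs)
  rw [hderiv, christoffel_smul_left, ← smul_neg]
  exact (hV e he (φ s) (hφJ hs) hXs).scomp s (hφ s hs).hasDerivAt

lemma IsParallelAlong.eventually_hasDerivAt (hV : IsParallelAlong D J X V) {t : ℝ}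
    (hJ : J ∈ 𝓝 t) (hX : ContinuousAt X t) {e : OpenPartialHomeomorph M (Coord m)}
    (he : e ∈ IsManifold.maximalAtlas (𝓡 (m + 1)) ∞ M) (ht : X t ∈ e.source) :
    ∀ᶠ s in 𝓝 t, HasDerivAt (fun r => tangentCoord e (X r) (V r))
      ((-christoffelCLM D e (e (X s)) (deriv (e ∘ X) s)) (tangentCoord e (X s) (V s))) s := by
  filter_upwards [hJ, hX.eventually_mem (e.open_source.mem_nhds ht)] with s hs hXs
  rw [_root_.neg_apply, christoffelCLM_apply D he (e.map_source hXs)]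
  exact hV e he s hs hXs

lemma HasContinuousCoefficients.isBoundedUnder_christoffelCLM
    (hD : HasContinuousCoefficients D) {e : OpenPartialHomeomorph M (Coord m)}
    (he : e ∈ IsManifold.maximalAtlas (𝓡 (m + 1)) ∞ M) {t : ℝ}
    (hX : ContMDiffAt 𝓘(ℝ, ℝ) (𝓡 (m + 1)) 1 X t) (ht : X t ∈ e.source) :
    (𝓝 t).IsBoundedUnder (· ≤ ·)
      fun s => ‖-christoffelCLM D e (e (X s)) (deriv (e ∘ X) s)‖ := by
  have hcoord := contDiffAt_chart_comp (n := 1) he hX ht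
  have hΓ : ContinuousAt (christoffelCLM D e ∘ (e ∘ X)) t :=
    ContinuousAt.comp (f := e ∘ X) (x := t) ((hD.continuousOn_christoffelCLM he).continuousAt
      (e.open_target.mem_nhds (e.map_source ht))) hcoord.continuousAt
  have hderiv : ContinuousAt (deriv (e ∘ X)) t :=
    (hcoord.derivWithin (m := 0) (by norm_num)).continuousAt
  exact (hΓ.clm_apply hderiv).neg.norm.isBoundedUnder_le

lemma IsParallelAlong.eventually_mk_eq_iff (hD : HasContinuousCoefficients D)
    (hV : IsParallelAlong D J X V) (hW : IsParallelAlong D J Y W) (hXY : EqOn X Y J) {t : ℝ}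
    (hJ : J ∈ 𝓝 t) (hX : ContMDiffAt 𝓘(ℝ, ℝ) (𝓡 (m + 1)) 1 X t) :
    ∀ᶠ s in 𝓝 t, ((⟨X t, V t⟩ : TangentBundle (𝓡 (m + 1)) M) = ⟨Y t, W t⟩ ↔
      (⟨X s, V s⟩ : TangentBundle (𝓡 (m + 1)) M) = ⟨Y s, W s⟩) := by
  have he := IsManifold.chart_mem_maximalAtlas (I := 𝓡 (m + 1)) (n := ∞) (X t)
  have ht := mem_chart_source (Coord m) (X t)
  set e := chartAt (Coord m) (X t)
  have hXY' : X =ᶠ[𝓝 t] Y := eventually_of_mem hJ hXY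
  have hW' : ∀ᶠ s in 𝓝 t, HasDerivAt (fun r => tangentCoord e (Y r) (W r))
      ((-christoffelCLM D e (e (X s)) (deriv (e ∘ X) s)) (tangentCoord e (Y s) (W s))) s := by
    filter_upwards [hXY'.eventuallyEq_nhds, hW.eventually_hasDerivAt hJ
      (hX.continuousAt.congr hXY') he (hXY'.self_of_nhds ▸ ht)] with s hXYs hWs
    rwa [(hXYs.fun_comp e).deriv_eq, hXYs.self_of_nhds]
  filter_upwards [hXY', hX.continuousAt.eventually_mem (e.open_source.mem_nhds ht),
    eventually_eq_iff_eq_of_linear_ode (hD.isBoundedUnder_christoffelCLM he hX ht)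
      (hV.eventually_hasDerivAt hJ hX.continuousAt he ht) hW'] with s hXYs hs hiff
  rwa [tangentBundle_mk_eq_iff he ht hXY'.self_of_nhds, tangentBundle_mk_eq_iff he hs hXYs]

lemma IsParallelAlong.eqOn_of_mk_eq (hD : HasContinuousCoefficients D)
    (hV : IsParallelAlong D J X V) (hW : IsParallelAlong D J Y W) (hXY : EqOn X Y J)
    (hJ : IsOpen J) (hJ' : IsPreconnected J) (hX : ContMDiffOn 𝓘(ℝ, ℝ) (𝓡 (m + 1)) 1 X J)
    {t₀ : ℝ} (ht₀ : t₀ ∈ J)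
    (h₀ : (⟨X t₀, V t₀⟩ : TangentBundle (𝓡 (m + 1)) M) = ⟨Y t₀, W t₀⟩) :
    EqOn (fun s => (⟨X s, V s⟩ : TangentBundle (𝓡 (m + 1)) M)) (fun s => ⟨Y s, W s⟩) J :=
  fun _ hs => (hJ'.induction₂
    (fun x y => (⟨X x, V x⟩ : TangentBundle (𝓡 (m + 1)) M) = ⟨Y x, W x⟩ ↔
      (⟨X y, V y⟩ : TangentBundle (𝓡 (m + 1)) M) = ⟨Y y, W y⟩)
    (fun _ ht => (hV.eventually_mk_eq_iff hD hW hXY (hJ.mem_nhds ht)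
      (hX.contMDiffAt (hJ.mem_nhds ht))).filter_mono nhdsWithin_le_nhds)
    (fun _ _ _ _ _ _ => Iff.trans) (fun _ _ _ _ => Iff.symm) ht₀ hs).1 h₀

end ParallelFields

section Geodesics

variable {m : ℕ} {M : Type*} [TopologicalSpace M] [ChartedSpace (Coord m) M]
  {J : Set ℝ} {γ : ℝ → M}

lemma eventually_eq_of_velocity_eq_zero [IsManifold (𝓡 (m + 1)) ∞ M] {t : ℝ}
    (hγ : ∀ᶠ s in 𝓝 t, MDifferentiableAt 𝓘(ℝ, ℝ) (𝓡 (m + 1)) γ s)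
    (h : ∀ᶠ s in 𝓝 t, velocity (m := m) γ s = 0) : ∀ᶠ s in 𝓝 t, γ t = γ s := by
  have he := IsManifold.chart_mem_maximalAtlas (I := 𝓡 (m + 1)) (n := ∞) (γ t)
  have ht := mem_chart_source (Coord m) (γ t)
  set e := chartAt (Coord m) (γ t)
  obtain ⟨ε, hε, hball⟩ := Metric.eventually_nhds_iff_ball.1 (hγ.and (h.and
    (hγ.self_of_nhds.continuousAt.eventually_mem (e.open_source.mem_nhds ht))))
  have hderiv : ∀ s ∈ Metric.ball t ε, HasDerivAt (e ∘ γ) 0 s := fun s hs => by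
    obtain ⟨hγs, hvel, hsrc⟩ := hball s hs
    rw [← tangentCoord_zero e (γ s), ← hvel]
    exact hasDerivAt_chart_comp he hγs hsrc
  filter_upwards [Metric.ball_mem_nhds t hε] with s hs
  exact e.injOn ht (hball s hs).2.2 (Metric.isOpen_ball.is_const_of_deriv_eq_zero (f := e ∘ γ)
    (convex_ball t ε).isPreconnected
    (fun r hr => (hderiv r hr).differentiableAt.differentiableWithinAt)
    (fun r hr => (hderiv r hr).deriv) (Metric.mem_ball_self hε) hs)

lemma eq_of_velocity_eq_zero [IsManifold (𝓡 (m + 1)) ∞ M] (hJ : IsOpen J)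
    (hJ' : IsPreconnected J)
    (hγ : ∀ s ∈ J, MDifferentiableAt 𝓘(ℝ, ℝ) (𝓡 (m + 1)) γ s)
    (h : ∀ s ∈ J, velocity (m := m) γ s = 0) {s t : ℝ} (hs : s ∈ J) (ht : t ∈ J) :
    γ s = γ t :=
  hJ'.induction₂ (fun x y => γ x = γ y)
    (fun _ hx => (eventually_eq_of_velocity_eq_zero (eventually_of_mem (hJ.mem_nhds hx) hγ)
      (eventually_of_mem (hJ.mem_nhds hx) h)).filter_mono nhdsWithin_le_nhds)
    (fun _ _ _ _ _ _ => Eq.trans) (fun _ _ _ _ => Eq.symm) hs ht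

variable [IsManifold (𝓡 (m + 1)) ∞ M] {D : AffineConnection m M}

lemma SolvesGeodesicEq.mdifferentiableAt (hγ : SolvesGeodesicEq D J γ) (hJ : IsOpen J) {s : ℝ}
    (hs : s ∈ J) : MDifferentiableAt 𝓘(ℝ, ℝ) (𝓡 (m + 1)) γ s :=
  (hγ.smooth.contMDiffAt (hJ.mem_nhds hs)).mdifferentiableAt (by simp)

lemma SolvesGeodesicEq.isParallelAlong_velocity (hγ : SolvesGeodesicEq D J γ) (hJ : IsOpen J) :
    IsParallelAlong D J γ (velocity γ) := fun e he s hs hγs => by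
  have hsmooth := hγ.smooth.contMDiffAt (hJ.mem_nhds hs)
  have hcoord : deriv (e ∘ γ) =ᶠ[𝓝 s] fun t => tangentCoord e (γ t) (velocity γ t) := by
    filter_upwards [hJ.mem_nhds hs,
      hsmooth.continuousAt.eventually_mem (e.open_source.mem_nhds hγs)] with t ht hγt
      using (hasDerivAt_chart_comp he (hγ.mdifferentiableAt hJ ht) hγt).deriv
  have hcoord_s : deriv (e ∘ γ) s = tangentCoord e (γ s) (velocity γ s) := hcoord.self_of_nhds
  rw [← hcoord_s, ← eq_neg_of_add_eq_zero_left (hγ.eq e he s hs hγs)]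
  exact (((contDiffAt_chart_comp (n := ⊤) he hsmooth hγs).derivWithin
    (m := ∞) (by simp)).differentiableAt (by simp)).hasDerivAt.congr_of_eventuallyEq hcoord.symm

lemma SolvesGeodesicEq.eq_of_velocity_eq_zero (hD : HasContinuousCoefficients D)
    (hγ : SolvesGeodesicEq D J γ) (hJ : IsOpen J) (hJ' : IsPreconnected J) {t₀ t : ℝ}
    (ht₀ : t₀ ∈ J) (h₀ : velocity (m := m) γ t₀ = 0) (ht : t ∈ J) : γ t = γ t₀ := by
  refine GenJacobi.eq_of_velocity_eq_zero hJ hJ' (fun s hs => hγ.mdifferentiableAt hJ hs)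
    (fun s hs => ?_) ht ht₀
  exact TotalSpace.mk_injective (F := Coord m) (γ s)
    ((hγ.isParallelAlong_velocity hJ).eqOn_of_mk_eq hD isParallelAlong_zero (eqOn_refl γ J) hJ hJ'
      (hγ.smooth.of_le (by simp)) ht₀ (congrArg (TotalSpace.mk' (Coord m) (γ t₀)) h₀) hs)

lemma solvesGeodesicEq_const (J : Set ℝ) (p : M) : SolvesGeodesicEq D J (fun _ => p) where
  smooth := contMDiffOn_const
  eq e _ s _ _ := by
    have hderiv : deriv (e ∘ fun _ : ℝ => p) = 0 := funext fun t => deriv_const t (e p)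
    have hΓ : christoffel D e (e p) 0 0 = 0 := by
      simpa using christoffel_smul_left D e (e p) 0 0 0
    simp [hderiv, hΓ]

lemma exp_zero (hD : HasContinuousCoefficients D) (p : M) : exp D ⟨p, 0⟩ = p := by
  have hex : ∃ q, ExpReaches D ⟨p, 0⟩ q := by
    refine ⟨p, univ, fun _ => p, ⟨isOpen_univ, ordConnected_univ, univ_nonempty⟩, mem_univ _,
      mem_univ _, solvesGeodesicEq_const _ p, congrArg (TotalSpace.mk' (Coord m) p) ?_, rfl⟩
    rw [velocity, mfderiv_const]
    rfl
  rw [exp, dif_pos hex]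
  obtain ⟨J, γ, hJ, h0, h1, hγ, hinit, hq⟩ := hex.choose_spec
  obtain ⟨rfl, hvel⟩ := TotalSpace.mk.inj hinit
  exact hq.symm.trans (hγ.eq_of_velocity_eq_zero hD hJ.isOpen hJ.ordConnected.isPreconnected h0
    (eq_of_heq hvel) h1)

end Geodesics

section AffineTransition

/-- On the open set `R` the charts `e` and `e'` are both defined and differ by the invertible
affine map `y ↦ Λ y + b`. -/
structure IsAffineTransition {M E E' : Type*} [TopologicalSpace M] [NormedAddCommGroup E]
    [NormedSpace ℝ E] [NormedAddCommGroup E'] [NormedSpace ℝ E'] (e : OpenPartialHomeomorph M E)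
    (e' : OpenPartialHomeomorph M E') (R : Set M) (Λ : E ≃L[ℝ] E') (b : E') : Prop where
  isOpen : IsOpen R
  subset_source : R ⊆ e.source
  subset_source' : R ⊆ e'.source
  apply_eq : ∀ q ∈ R, e' q = Λ (e q) + b

lemma isAffineTransition_transitionRegion {M E E' : Type*} [TopologicalSpace M]
    [NormedAddCommGroup E] [NormedSpace ℝ E] [NormedAddCommGroup E'] [NormedSpace ℝ E']
    {e : OpenPartialHomeomorph M E} {e' : OpenPartialHomeomorph M E'} {L : E → E'}
    {Λ : E ≃L[ℝ] E'} {b : E'} (hL : ∀ x, L x = Λ x + b)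
    (h : ∀ x ∈ e.target, L x ∈ e'.target → e.symm x = e'.symm (L x)) :
    IsAffineTransition e e' (transitionRegion e e' L) Λ b where
  isOpen := isOpen_transitionRegion <| by
    rw [funext hL]
    exact Λ.continuous.add continuous_const
  subset_source _ hq := hq.1
  subset_source' _ hq := (mem_source_and_apply_eq_of_mem_transitionRegion h hq).1
  apply_eq _ hq := (mem_source_and_apply_eq_of_mem_transitionRegion h hq).2.trans (hL _)

namespace IsAffineTransition

section NormedSpace

variable {M E E' : Type*} [TopologicalSpace M] [NormedAddCommGroup E] [NormedSpace ℝ E]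
  [NormedAddCommGroup E'] [NormedSpace ℝ E'] {e : OpenPartialHomeomorph M E}
  {e' : OpenPartialHomeomorph M E'} {R : Set M} {Λ : E ≃L[ℝ] E'} {b : E'} {q : M}

lemma eventually_symm_mem (h : IsAffineTransition e e' R Λ b) (hq : q ∈ R) :
    ∀ᶠ y in 𝓝 (e q), y ∈ e.target ∧ e.symm y ∈ R := by
  have htarget := e.map_source (h.subset_source hq)
  have hR : R ∈ 𝓝 (e.symm (e q)) := by
    rw [e.left_inv (h.subset_source hq)]
    exact h.isOpen.mem_nhds hq
  exact (e.open_target.eventually_mem htarget).and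
    ((e.symm.continuousAt htarget).eventually_mem hR)

lemma hasFDerivAt (h : IsAffineTransition e e' R Λ b) (hq : q ∈ R) :
    HasFDerivAt (e' ∘ e.symm) (Λ : E →L[ℝ] E') (e q) := by
  refine (Λ.hasFDerivAt.add_const b).congr_of_eventuallyEq ?_
  filter_upwards [h.eventually_symm_mem hq] with y hy
  rw [Function.comp_apply, h.apply_eq _ hy.2, e.right_inv hy.1]

end NormedSpace

variable {m : ℕ} {M : Type*} [TopologicalSpace M] [ChartedSpace (Coord m) M]
  {e e' : OpenPartialHomeomorph M (Coord m)} {R : Set M} {Λ : Coord m ≃L[ℝ] Coord m}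
  {b : Coord m} {q : M}

lemma tangentCoord_eq (h : IsAffineTransition e e' R Λ b)
    (he : e ∈ IsManifold.maximalAtlas (𝓡 (m + 1)) ∞ M) (hq : q ∈ R)
    (v : TangentSpace (𝓡 (m + 1)) q) : tangentCoord e' q v = Λ (tangentCoord e q v) := by
  have heq : (e' : M → Coord m) =ᶠ[𝓝 q] (fun y => Λ y + b) ∘ e :=
    eventually_of_mem (h.isOpen.mem_nhds hq) h.apply_eq
  have hcomp := (Λ.hasFDerivAt.add_const b).hasMFDerivAt.comp q
    ((mdifferentiable_of_mem_maximalAtlas he).mdifferentiableAt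
      (h.subset_source hq)).hasMFDerivAt
  exact congrArg (fun f : Coord m →L[ℝ] Coord m => f v)
    (hcomp.congr_of_eventuallyEq heq).mfderiv

lemma coordField_eq (h : IsAffineTransition e e' R Λ b)
    (he : e ∈ IsManifold.maximalAtlas (𝓡 (m + 1)) ∞ M)
    (he' : e' ∈ IsManifold.maximalAtlas (𝓡 (m + 1)) ∞ M) (hq : q ∈ R) (w : Coord m) :
    coordField e' (Λ w) q = coordField e w q := by
  refine tangentCoord_injective he' (h.subset_source' hq) ?_
  rw [tangentCoord_coordField he' _ (h.subset_source' hq), h.tangentCoord_eq he hq,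
    tangentCoord_coordField he _ (h.subset_source hq)]

variable [IsManifold (𝓡 (m + 1)) ∞ M] (D : AffineConnection m M)

lemma christoffel_eq (h : IsAffineTransition e e' R Λ b)
    (he : e ∈ IsManifold.maximalAtlas (𝓡 (m + 1)) ∞ M)
    (he' : e' ∈ IsManifold.maximalAtlas (𝓡 (m + 1)) ∞ M) (hq : q ∈ R) (v w : Coord m) :
    christoffel D e' (e' q) (Λ v) (Λ w) = Λ (christoffel D e (e q) v w) := by
  have hD : D (coordField e' (Λ w)) q = D (coordField e w) q :=
    D.isCovariantDerivativeOnUniv.congr_of_eventuallyEq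
      (mdifferentiableAt_coordField he' _ (h.subset_source' hq))
      (mdifferentiableAt_coordField he _ (h.subset_source hq)) univ_mem
      (eventually_of_mem (h.isOpen.mem_nhds hq) fun z hz => h.coordField_eq he he' hz w)
  unfold christoffel
  rw [e.left_inv (h.subset_source hq), e'.left_inv (h.subset_source' hq),
    h.coordField_eq he he' hq v, h.tangentCoord_eq he hq, hD]

lemma fderiv_christoffel_eq (h : IsAffineTransition e e' R Λ b)
    (he : e ∈ IsManifold.maximalAtlas (𝓡 (m + 1)) ∞ M)
    (he' : e' ∈ IsManifold.maximalAtlas (𝓡 (m + 1)) ∞ M) (hq : q ∈ R) (v w u : Coord m) :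
    fderiv ℝ (fun y => christoffel D e' y (Λ v) (Λ w)) (e' q) (Λ u) =
      Λ (fderiv ℝ (fun y => christoffel D e y v w) (e q) u) := by
  set Γ' : Coord m → Coord m := fun y => christoffel D e' y (Λ v) (Λ w)
  have heq : (fun y => Λ (christoffel D e y v w)) =ᶠ[𝓝 (e q)] (fun y => Γ' (y + b)) ∘ Λ := by
    filter_upwards [h.eventually_symm_mem hq] with y hy
    have hy' := h.christoffel_eq D he he' hy.2 v w
    rw [h.apply_eq _ hy.2, e.right_inv hy.1] at hy'
    exact hy'.symm
  calc fderiv ℝ Γ' (e' q) (Λ u)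
      = fderiv ℝ (fun y => Γ' (y + b)) (Λ (e q)) (Λ u) := by
        rw [fderiv_comp_add_right, h.apply_eq q hq]
    _ = fderiv ℝ ((fun y => Γ' (y + b)) ∘ Λ) (e q) u := by
        rw [Λ.comp_right_fderiv]
        rfl
    _ = fderiv ℝ (Λ ∘ fun y => christoffel D e y v w) (e q) u := by
        rw [← heq.fderiv_eq]
        rfl
    _ = Λ (fderiv ℝ (fun y => christoffel D e y v w) (e q) u) := by
        rw [Λ.comp_fderiv]
        rfl

variable {K : Set ℝ} {Y : ℝ → M} {ξ ξ' : ℝ → Coord m}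

lemma genJacobiOp_eq (h : IsAffineTransition e e' R Λ b)
    (he : e ∈ IsManifold.maximalAtlas (𝓡 (m + 1)) ∞ M)
    (he' : e' ∈ IsManifold.maximalAtlas (𝓡 (m + 1)) ∞ M) (hK : IsOpen K) (hY : MapsTo Y K R)
    (hYd : MDifferentiableOn 𝓘(ℝ, ℝ) (𝓡 (m + 1)) Y K) (hξ : ContDiffOn ℝ 2 ξ K)
    (hξ' : EqOn ξ' (Λ ∘ ξ) K) {s : ℝ} (hs : s ∈ K) :
    genJacobiOp D e' Y ξ' s = Λ (genJacobiOp D e Y ξ s) := by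
  have hderiv : EqOn (deriv ξ') (Λ ∘ deriv ξ) K := fun t ht => by
    have hdiff := (hξ.contDiffAt (hK.mem_nhds ht)).differentiableAt (by simp)
    rw [(hξ'.eventuallyEq_of_mem (hK.mem_nhds ht)).deriv_eq]
    exact (Λ.hasFDerivAt.comp_hasDerivAt t hdiff.hasDerivAt).deriv
  have hderiv2 : deriv (deriv ξ') s = Λ (deriv (deriv ξ) s) := by
    have hdiff := ((hξ.contDiffAt (hK.mem_nhds hs)).derivWithin
      (m := 1) (by norm_num)).differentiableAt (by simp)
    rw [(hderiv.eventuallyEq_of_mem (hK.mem_nhds hs)).deriv_eq]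
    exact (Λ.hasFDerivAt.comp_hasDerivAt s hdiff.hasDerivAt).deriv
  have hY' : deriv (e' ∘ Y) s = Λ (deriv (e ∘ Y) s) := by
    have hYs := (hYd s hs).mdifferentiableAt (hK.mem_nhds hs)
    rw [(hasDerivAt_chart_comp he' hYs (h.subset_source' (hY hs))).deriv,
      (hasDerivAt_chart_comp he hYs (h.subset_source (hY hs))).deriv,
      h.tangentCoord_eq he (hY hs)]
  unfold genJacobiOp
  rw [hderiv2, hderiv hs, hY', hξ' hs]
  simp only [Function.comp_apply, ← map_add, ← map_smul,
    h.fderiv_christoffel_eq D he he' (hY hs), h.christoffel_eq D he he' (hY hs)]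

lemma isGenJacobiField_iff (h : IsAffineTransition e e' R Λ b)
    (he : e ∈ IsManifold.maximalAtlas (𝓡 (m + 1)) ∞ M)
    (he' : e' ∈ IsManifold.maximalAtlas (𝓡 (m + 1)) ∞ M) (hK : IsOpen K) (hY : MapsTo Y K R)
    (hYd : MDifferentiableOn 𝓘(ℝ, ℝ) (𝓡 (m + 1)) Y K) (hξ' : EqOn ξ' (Λ ∘ ξ) K) :
    IsGenJacobiField D e K Y ξ ↔ IsGenJacobiField D e' K Y ξ' := by
  have hiff : ContDiffOn ℝ 2 ξ' K ↔ ContDiffOn ℝ 2 ξ K :=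
    (contDiffOn_congr hξ').trans Λ.comp_contDiffOn_iff
  have hop : ContDiffOn ℝ 2 ξ K → ∀ s ∈ K,
      (genJacobiOp D e' Y ξ' s = 0 ↔ genJacobiOp D e Y ξ s = 0) := fun hξ s hs => by
    rw [h.genJacobiOp_eq D he he' hK hY hYd hξ hξ' hs, map_eq_zero_iff Λ Λ.injective]
  exact ⟨fun hF => ⟨hiff.2 hF.contDiffOn, fun s hs => (hop hF.contDiffOn s hs).2 (hF.eq_zero s hs)⟩,
    fun hF => ⟨hiff.1 hF.contDiffOn,
      fun s hs => (hop (hiff.1 hF.contDiffOn) s hs).1 (hF.eq_zero s hs)⟩⟩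

end IsAffineTransition

end AffineTransition

section FermiAffine

variable {m : ℕ}

/-- The unit vector along the `s`-axis `z = 0` of the coordinate space of Fermi coordinates. -/
noncomputable def axisVec (m : ℕ) : Coord m := EuclideanSpace.single 0 1

@[simp] lemma axisVec_zero : axisVec m 0 = 1 := by simp [axisVec]

@[simp] lemma axisVec_succ (i : Fin m) : axisVec m i.succ = 0 := by simp [axisVec]

lemma smul_axisVec_injective : Function.Injective fun s : ℝ => s • axisVec m := fun s t h => by
  simpa using congrArg (fun y : Coord m => y 0) h

@[simp] lemma fermiAffine_zero (A B : ℝ) (T : Matrix (Fin m) (Fin m) ℝ) (x : Coord m) :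
    fermiAffine A B T x 0 = A * x 0 + B := rfl

@[simp] lemma fermiAffine_succ (A B : ℝ) (T : Matrix (Fin m) (Fin m) ℝ) (x : Coord m)
    (i : Fin m) : fermiAffine A B T x i.succ = (T *ᵥ fun j => x j.succ) i := rfl

lemma fermiAffine_smul_axisVec (A B : ℝ) (T : Matrix (Fin m) (Fin m) ℝ) (s : ℝ) :
    fermiAffine A B T (s • axisVec m) = (A * s + B) • axisVec m := by
  ext i
  refine Fin.cases ?_ (fun j => ?_) i <;> simp [mulVec, dotProduct]

/-- The linear part `(s, z) ↦ (A s, T z)` of `fermiAffine A B T`. -/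
noncomputable def fermiLinear (A : ℝ) (T : Matrix (Fin m) (Fin m) ℝ) : Coord m →ₗ[ℝ] Coord m where
  toFun := fermiAffine A 0 T
  map_add' x y := by
    ext i
    refine Fin.cases ?_ (fun j => ?_) i
    · simp [mul_add]
    · exact congrFun (mulVec_add T (fun j => x j.succ) fun j => y j.succ) j
  map_smul' c x := by
    ext i
    refine Fin.cases ?_ (fun j => ?_) i
    · simp [mul_left_comm]
    · exact congrFun (mulVec_smul T c fun j => x j.succ) j

lemma fermiAffine_eq_fermiLinear_add (A B : ℝ) (T : Matrix (Fin m) (Fin m) ℝ) (x : Coord m) :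
    fermiAffine A B T x = fermiLinear A T x + B • axisVec m := by
  change _ = fermiAffine A 0 T x + _
  ext i
  refine Fin.cases ?_ (fun j => ?_) i <;> simp

lemma continuous_fermiAffine (A B : ℝ) (T : Matrix (Fin m) (Fin m) ℝ) :
    Continuous (fermiAffine A B T) := by
  rw [funext (fermiAffine_eq_fermiLinear_add A B T)]
  exact (fermiLinear A T).continuous_of_finiteDimensional.add continuous_const

lemma fermiLinear_injective {A : ℝ} (hA : A ≠ 0) {T : Matrix (Fin m) (Fin m) ℝ}
    (hT : IsUnit T) : Function.Injective (fermiLinear A T) := by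
  rw [injective_iff_map_eq_zero]
  intro x hx
  have hs : A * x 0 + 0 = 0 := congrArg (fun y : Coord m => y 0) hx
  have hz : T *ᵥ (fun j => x j.succ) = T *ᵥ 0 := by
    rw [mulVec_zero]
    exact funext fun i => congrArg (fun y : Coord m => y i.succ) hx
  ext i
  refine Fin.cases ?_ (fun j => ?_) i
  · simpa [hA] using hs
  · exact congrFun (mulVec_injective_iff_isUnit.2 hT hz) j

lemma exists_continuousLinearEquiv_fermiAffine_eq {A : ℝ} (hA : A ≠ 0) (B : ℝ)
    {T : Matrix (Fin m) (Fin m) ℝ} (hT : IsUnit T) :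
    ∃ Λ : Coord m ≃L[ℝ] Coord m, ∀ x, fermiAffine A B T x = Λ x + B • axisVec m :=
  ⟨(LinearEquiv.ofInjectiveEndo _ (fermiLinear_injective hA hT)).toContinuousLinearEquiv,
    fermiAffine_eq_fermiLinear_add A B T⟩

end FermiAffine

section FermiCoordinates

variable {m : ℕ} {M : Type*} [TopologicalSpace M] [ChartedSpace (Coord m) M]
  [IsManifold (𝓡 (m + 1)) ∞ M] {D : AffineConnection m M} {J K : Set ℝ} {X γ : ℝ → M}

namespace FermiCoordinates

lemma smul_axisVec_mem_target (F : FermiCoordinates D J X) {s : ℝ} (hs : s ∈ J) :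
    s • axisVec m ∈ F.chart.target := by
  rw [F.target_eq]
  exact ⟨by simpa using hs, by simpa using! F.zero_mem_B⟩

lemma symm_smul_axisVec (F : FermiCoordinates D J X) (hD : HasContinuousCoefficients D) {s : ℝ}
    (hs : s ∈ J) : F.chart.symm (s • axisVec m) = X s := by
  have hz : ∀ i : Fin m, (s • axisVec m) i.succ = 0 := by simp
  simp only [F.symm_eq _ (F.smul_axisVec_mem_target hs), hz, zero_smul, Finset.sum_const_zero,
    exp_zero hD]
  simp

lemma mem_source (F : FermiCoordinates D J X) (hD : HasContinuousCoefficients D) {s : ℝ}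
    (hs : s ∈ J) : X s ∈ F.chart.source := by
  rw [← F.symm_smul_axisVec hD hs]
  exact F.chart.map_target (F.smul_axisVec_mem_target hs)

lemma chart_apply (F : FermiCoordinates D J X) (hD : HasContinuousCoefficients D) {s : ℝ}
    (hs : s ∈ J) : F.chart (X s) = s • axisVec m := by
  rw [← F.symm_smul_axisVec hD hs, F.chart.right_inv (F.smul_axisVec_mem_target hs)]

lemma injOn (F : FermiCoordinates D J X) (hD : HasContinuousCoefficients D) : InjOn X J :=
  fun s hs t ht h => smul_axisVec_injective (m := m) <| by
    simpa only [F.chart_apply hD hs, F.chart_apply hD ht] using congrArg F.chart h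

lemma deriv_chart_comp (F : FermiCoordinates D J X) (hD : HasContinuousCoefficients D)
    (hJ : IsOpen J) {s : ℝ} (hs : s ∈ J) : deriv (F.chart ∘ X) s = axisVec m := by
  have h : F.chart ∘ X =ᶠ[𝓝 s] fun t => t • axisVec m :=
    eventually_of_mem (hJ.mem_nhds hs) fun t ht => F.chart_apply hD ht
  rw [h.deriv_eq]
  simpa using ((hasDerivAt_id s).smul_const (axisVec m)).deriv

lemma christoffel_axisVec (F : FermiCoordinates D J X) (hD : HasContinuousCoefficients D)
    (hJ : IsOpen J) (hX : SolvesGeodesicEq D J X) {s : ℝ} (hs : s ∈ J) :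
    christoffel D F.chart (s • axisVec m) (axisVec m) (axisVec m) = 0 := by
  have hconst : deriv (F.chart ∘ X) =ᶠ[𝓝 s] fun _ => axisVec m :=
    eventually_of_mem (hJ.mem_nhds hs) fun t ht => F.deriv_chart_comp hD hJ ht
  simpa only [hconst.deriv_eq, deriv_const, F.deriv_chart_comp hD hJ hs, F.chart_apply hD hs,
    zero_add] using hX.eq F.chart F.chart_mem s hs (F.mem_source hD hs)

lemma deriv_deriv_eq_zero_of_eqOn_comp (F : FermiCoordinates D J X)
    (hD : HasContinuousCoefficients D) (hJ : IsOpen J) (hX : SolvesGeodesicEq D J X)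
    (hK : IsOpen K) (hγ : SolvesGeodesicEq D K γ) {φ : ℝ → ℝ} (hφ : ContDiffOn ℝ 2 φ K)
    (hφJ : MapsTo φ K J) (hcomp : EqOn γ (X ∘ φ) K) : EqOn (deriv (deriv φ)) 0 K := by
  have hcoord : EqOn (F.chart ∘ γ) (fun s => φ s • axisVec m) K := fun s hs =>
    (congrArg F.chart (hcomp hs)).trans (F.chart_apply hD (hφJ hs))
  have hderiv : EqOn (deriv (F.chart ∘ γ)) (fun s => deriv φ s • axisVec m) K := fun s hs => by
    have hdiff := (hφ.contDiffAt (hK.mem_nhds hs)).differentiableAt (by simp)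
    rw [(hcoord.eventuallyEq_of_mem (hK.mem_nhds hs)).deriv_eq]
    exact (hdiff.hasDerivAt.smul_const (axisVec m)).deriv
  intro s hs
  have hdiff := ((hφ.contDiffAt (hK.mem_nhds hs)).derivWithin
    (m := 1) (by norm_num)).differentiableAt (by simp)
  have hsource : γ s ∈ F.chart.source := hcomp hs ▸ F.mem_source hD (hφJ hs)
  have hgeod := hγ.eq F.chart F.chart_mem s hs hsource
  have hcoord_s : F.chart (γ s) = φ s • axisVec m := hcoord hs
  rw [(hderiv.eventuallyEq_of_mem (hK.mem_nhds hs)).deriv_eq,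
    (hdiff.hasDerivAt.smul_const (axisVec m)).deriv, hderiv hs, hcoord_s, christoffel_smul_left,
    christoffel_smul_right D F.chart_mem (F.smul_axisVec_mem_target (hφJ hs)),
    F.christoffel_axisVec hD hJ hX (hφJ hs), smul_zero, smul_zero, add_zero] at hgeod
  simpa using congrArg (fun y : Coord m => y 0) hgeod

lemma exists_eqOn_comp_affine (F : FermiCoordinates D J X) (hD : HasContinuousCoefficients D)
    (hJ : IsOpen J) (hX : SolvesGeodesicEq D J X) (hK : IsOpen K) (hK' : IsPreconnected K)
    (hγ : SolvesGeodesicEq D K γ) (hγX : γ '' K ⊆ X '' J) :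
    ∃ A B : ℝ, MapsTo (fun s => A * s + B) K J ∧ EqOn γ (X ∘ fun s => A * s + B) K := by
  set φ : ℝ → ℝ := fun s => F.chart (γ s) 0
  have hφ : ∀ s ∈ K, φ s ∈ J ∧ γ s = X (φ s) := fun s hs => by
    obtain ⟨t, ht, hts⟩ := hγX (mem_image_of_mem γ hs)
    have hφt : φ s = t := by simp [φ, ← hts, F.chart_apply hD ht]
    exact hφt ▸ ⟨ht, hts.symm⟩
  have hsmooth : ContDiffOn ℝ ∞ φ K := fun s hs => by
    have hcoord : ContDiffAt ℝ ∞ (F.chart ∘ γ) s :=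
      contDiffAt_chart_comp (n := ⊤) F.chart_mem (hγ.smooth.contMDiffAt (hK.mem_nhds hs))
        ((hφ s hs).2 ▸ F.mem_source hD (hφ s hs).1)
    exact ((contDiffAt_piLp 2).1 hcoord 0).contDiffWithinAt
  have hφ'' := F.deriv_deriv_eq_zero_of_eqOn_comp hD hJ hX hK hγ
    (hsmooth.of_le ENat.LEInfty.out) (fun s hs => (hφ s hs).1) fun s hs => (hφ s hs).2
  obtain ⟨A, B, hAB⟩ := exists_eq_smul_add_of_deriv_deriv_eq_zero hK hK'
    (hsmooth.differentiableOn (by simp))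
    ((hsmooth.deriv_of_isOpen hK (m := ∞) (by simp)).differentiableOn (by simp)) hφ''
  have hAB' : ∀ s ∈ K, φ s = A * s + B := fun s hs => by
    rw [hAB s hs, smul_eq_mul, mul_comm]
  exact ⟨A, B, fun s hs => show A * s + B ∈ J from hAB' s hs ▸ (hφ s hs).1,
    fun s hs => (hφ s hs).2.trans (congrArg X (hAB' s hs))⟩

end FermiCoordinates

end FermiCoordinates

section Comparison

lemma IsReparametrization.image_subset {M : Type*} {J J' : Set ℝ} {X X' : ℝ → M}
    (h : IsReparametrization J X J' X') :
    X '' J ⊆ X' '' J' := by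
  obtain ⟨ψ, -, -, hψ, hcomp⟩ := h
  exact image_subset_iff.2 fun s hs => ⟨ψ s, hψ.mapsTo hs, (hcomp s hs).symm⟩

variable {m : ℕ} {M : Type*} [TopologicalSpace M] [ChartedSpace (Coord m) M]
  [IsManifold (𝓡 (m + 1)) ∞ M] {D : AffineConnection m M} {J J' : Set ℝ} {X X' : ℝ → M}
  {A B : ℝ} {T : Matrix (Fin m) (Fin m) ℝ}

namespace FermiCoordinates

lemma ne_zero_of_eqOn_comp_affine (F : FermiCoordinates D J X) (hD : HasContinuousCoefficients D)
    (hJ : IsOpen J) (hcomp : EqOn X (X' ∘ fun s => A * s + B) J) : A ≠ 0 := by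
  rintro rfl
  obtain ⟨s, hs, t, ht, hst⟩ := (infinite_of_mem_nhds F.s₀ (hJ.mem_nhds F.s₀_mem)).nontrivial
  exact hst (F.injOn hD hs ht (by simp only [hcomp hs, hcomp ht, Function.comp_apply, zero_mul]))

lemma base_eq_of_hyperplane_eq {F : FermiCoordinates D J X} {F' : FermiCoordinates D J' X'}
    (hPi : F.hyperplane = F'.hyperplane) : X F.s₀ = X' F'.s₀ := by
  obtain ⟨w, -, hw⟩ := hPi.subset (mem_image_of_mem _ (Submodule.zero_mem _))
  exact (congrArg TotalSpace.proj hw).symm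

lemma exists_isUnit_mk_sum_frame_eq {F : FermiCoordinates D J X} {F' : FermiCoordinates D J' X'}
    (hD : HasContinuousCoefficients D) (hPi : F.hyperplane = F'.hyperplane)
    (hAB : MapsTo (fun s => A * s + B) J J') (hcomp : EqOn X (X' ∘ fun s => A * s + B) J)
    (hJ : IsOpen J) (hJ' : IsPreconnected J)
    (hX : ContMDiffOn 𝓘(ℝ, ℝ) (𝓡 (m + 1)) 1 X J)
    (hX' : ∀ t ∈ J', MDifferentiableAt 𝓘(ℝ, ℝ) (𝓡 (m + 1)) X' t) :
    ∃ T : Matrix (Fin m) (Fin m) ℝ, IsUnit T ∧ ∀ z : Fin m → ℝ, ∀ s ∈ J,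
      (⟨X s, ∑ i, z i • F.frame i s⟩ : TangentBundle (𝓡 (m + 1)) M) =
        ⟨X' (A * s + B), ∑ j, (T *ᵥ z) j • F'.frame j (A * s + B)⟩ := by
  obtain ⟨T, hT, hframe⟩ := exists_isUnit_matrix_mk_sum_smul_eq F.linearIndependent hPi
  have hs₀ : F'.s₀ = A * F.s₀ + B := F'.injOn hD F'.s₀_mem (hAB F.s₀_mem)
    ((base_eq_of_hyperplane_eq hPi).symm.trans (hcomp F.s₀_mem))
  rw [hs₀] at hframe
  exact ⟨T, hT, fun z => (IsParallelAlong.sum_smul F.parallel _ z).eqOn_of_mk_eq hD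
    ((IsParallelAlong.sum_smul F'.parallel _ (T *ᵥ z)).comp hX' (fun s _ => by fun_prop) hAB)
    hcomp hJ hJ' hX F.s₀_mem (hframe z)⟩

lemma symm_eq_symm_fermiAffine (F : FermiCoordinates D J X) (F' : FermiCoordinates D J' X')
    (hframe : ∀ z : Fin m → ℝ, ∀ s ∈ J,
      (⟨X s, ∑ i, z i • F.frame i s⟩ : TangentBundle (𝓡 (m + 1)) M) =
        ⟨X' (A * s + B), ∑ j, (T *ᵥ z) j • F'.frame j (A * s + B)⟩)
    {x : Coord m} (hx : x ∈ F.chart.target) (hLx : fermiAffine A B T x ∈ F'.chart.target) :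
    F.chart.symm x = F'.chart.symm (fermiAffine A B T x) := by
  have hx0 : x 0 ∈ J := (F.target_eq.subset hx).1
  rw [F.symm_eq x hx, F'.symm_eq _ hLx]
  exact congrArg (exp D) (hframe _ _ hx0)

lemma mem_transitionRegion_fermiAffine (F : FermiCoordinates D J X)
    (F' : FermiCoordinates D J' X') (hD : HasContinuousCoefficients D)
    (T : Matrix (Fin m) (Fin m) ℝ) {s : ℝ} (hs : s ∈ J) (hs' : A * s + B ∈ J') :
    X s ∈ transitionRegion F.chart F'.chart (fermiAffine A B T) := by
  refine ⟨F.mem_source hD hs, ?_⟩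
  rw [mem_preimage, mem_preimage, F.chart_apply hD hs, fermiAffine_smul_axisVec]
  exact F'.smul_axisVec_mem_target hs'

lemma image_subset_connectedComponentIn (F : FermiCoordinates D J X)
    (F' : FermiCoordinates D J' X') (hD : HasContinuousCoefficients D) (hJ : IsPreconnected J)
    (hX : ContinuousOn X J) (hXX' : X '' J ⊆ X' '' J') :
    X '' J ⊆ connectedComponentIn (F.chart.source ∩ F'.chart.source) (X F.s₀) :=
  (hJ.image X hX).subset_connectedComponentIn (mem_image_of_mem X F.s₀_mem) <| subset_inter
    (image_subset_iff.2 fun _ hs => F.mem_source hD hs)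
    (hXX'.trans (image_subset_iff.2 fun _ hs => F'.mem_source hD hs))

lemma exists_symm_eq_symm_fermiAffine (F : FermiCoordinates D J X)
    (F' : FermiCoordinates D J' X') (hD : HasContinuousCoefficients D)
    (hPi : F.hyperplane = F'.hyperplane) (hJ : IsOpen J) (hJc : IsPreconnected J)
    (hX : SolvesGeodesicEq D J X) (hJ' : IsOpen J') (hX' : SolvesGeodesicEq D J' X')
    (hXX' : X '' J ⊆ X' '' J') :
    ∃ (A B : ℝ) (T : Matrix (Fin m) (Fin m) ℝ), A ≠ 0 ∧ IsUnit T ∧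
      MapsTo (fun s => A * s + B) J J' ∧ ∀ x ∈ F.chart.target,
        fermiAffine A B T x ∈ F'.chart.target →
          F.chart.symm x = F'.chart.symm (fermiAffine A B T x) := by
  obtain ⟨A, B, hAB, hcomp⟩ := F'.exists_eqOn_comp_affine hD hJ' hX' hJ hJc hX hXX'
  obtain ⟨T, hT, hframe⟩ := exists_isUnit_mk_sum_frame_eq hD hPi hAB hcomp hJ hJc
    (hX.smooth.of_le (by simp)) fun _ ht => hX'.mdifferentiableAt hJ' ht
  exact ⟨A, B, T, F.ne_zero_of_eqOn_comp_affine hD hJ hcomp, hT, hAB,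
    fun _ => F.symm_eq_symm_fermiAffine F' hframe⟩

end FermiCoordinates

end Comparison

end GenJacobi

open GenJacobi Topology

theorem mainTheorem3_general {m : ℕ} {M : Type*} [TopologicalSpace M] [T2Space M]
    [ChartedSpace (Coord m) M] [IsManifold (𝓡 (m + 1)) ∞ M] (D : AffineConnection m M)
    (k : ℕ∞) [CovariantDerivative.ContMDiffCovariantDerivative D (k + 1 : ℕ∞)]
    (J J' : Set ℝ) (X X' : ℝ → M) (hX : IsGeodesic D J X) (hX' : IsGeodesic D J' X')
    (hXX' : X '' J ⊆ X' '' J') (F : FermiCoordinates D J X) (F' : FermiCoordinates D J' X')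
    (hPi : F.hyperplane = F'.hyperplane) :
    let W : Set M := connectedComponentIn (F.chart.source ∩ F'.chart.source) (X F.s₀)
    (∀ s ∈ J, X s ∈ W) ∧
    ∃ (A B : ℝ) (T : Matrix (Fin m) (Fin m) ℝ), A ≠ 0 ∧ IsUnit T ∧
      (∀ q ∈ W, F'.chart q = fermiAffine A B T (F.chart q)) ∧
      (∀ q ∈ F.chart.source, fermiAffine A B T (F.chart q) ∈ F'.chart.target →
        q ∈ F'.chart.source ∧ F'.chart q = fermiAffine A B T (F.chart q)) ∧
      (∀ (K : Set ℝ) (Y : ℝ → M), IsOpen K → MDifferentiableOn 𝓘(ℝ, ℝ) (𝓡 (m + 1)) Y K →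
        (∀ s ∈ K, Y s ∈ F.chart.source ∧
          fermiAffine A B T (F.chart (Y s)) ∈ F'.chart.target) →
        ∀ ξ ξ' : ℝ → Coord m,
          (∀ s ∈ K, ξ' s = fderiv ℝ (F'.chart ∘ F.chart.symm) (F.chart (Y s)) (ξ s)) →
          (ContDiffOn ℝ 2 ξ K → ∀ s ∈ K,
            genJacobiOp D F'.chart Y ξ' s =
              fderiv ℝ (F'.chart ∘ F.chart.symm) (F.chart (Y s))
                (genJacobiOp D F.chart Y ξ s)) ∧
          (IsGenJacobiField D F.chart K Y ξ ↔ IsGenJacobiField D F'.chart K Y ξ')) := by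
  intro W
  have hD := hasContinuousCoefficients D (k + 1)
  have hJ := hX.interval.ordConnected.isPreconnected
  obtain ⟨A, B, T, hA, hT, hAB, hsymm⟩ := F.exists_symm_eq_symm_fermiAffine F' hD hPi
    hX.interval.isOpen hJ hX.solves hX'.interval.isOpen hX'.solves hXX'
  obtain ⟨Λ, hΛ⟩ := exists_continuousLinearEquiv_fermiAffine_eq hA B hT
  have htrans := isAffineTransition_transitionRegion hΛ hsymm
  have hXW : X '' J ⊆ W :=
    F.image_subset_connectedComponentIn F' hD hJ hX.solves.smooth.continuousOn hXX'
  have hX₀ : X F.s₀ ∈ X '' J := mem_image_of_mem X F.s₀_mem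
  have hWR : W ⊆ transitionRegion F.chart F'.chart (fermiAffine A B T) :=
    subset_transitionRegion_of_isPreconnected (continuous_fermiAffine A B T) hsymm
      isPreconnected_connectedComponentIn (connectedComponentIn_subset _ _) ⟨X F.s₀, hXW hX₀,
        F.mem_transitionRegion_fermiAffine F' hD T F.s₀_mem (hAB F.s₀_mem)⟩
  have hchart := fun q => mem_source_and_apply_eq_of_mem_transitionRegion hsymm (q := q)
  refine ⟨fun s hs => hXW (mem_image_of_mem X hs), A, B, T, hA, hT, fun q hq =>
    (hchart q (hWR hq)).2, fun q hq hLq => hchart q ⟨hq, hLq⟩, fun K Y hK hY hYR ξ ξ' hξ => ?_⟩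
  have hfderiv : ∀ s ∈ K, fderiv ℝ (F'.chart ∘ F.chart.symm) (F.chart (Y s)) =
      (Λ : Coord m →L[ℝ] Coord m) := fun s hs => (htrans.hasFDerivAt (hYR s hs)).fderiv
  have hξ' : EqOn ξ' (Λ ∘ ξ) K := fun s hs => by simp [hξ s hs, hfderiv s hs]
  refine ⟨fun hξ2 s hs => ?_, htrans.isGenJacobiField_iff D F.chart_mem F'.chart_mem hK hYR hY hξ'⟩
  rw [hfderiv s hs]
  exact htrans.genJacobiOp_eq D F.chart_mem F'.chart_mem hK hYR hY hξ2 hξ' hs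

theorem mainTheorem3 {m : ℕ} {M : Type*} [TopologicalSpace M] [T2Space M]
    [ChartedSpace (GenJacobi.Coord m) M] [IsManifold (𝓡 (m + 1)) ∞ M]
    (D : GenJacobi.AffineConnection m M)
    [CovariantDerivative.ContMDiffCovariantDerivative D ∞]
    (J J' : Set ℝ) (X X' : ℝ → M)
    (hX : GenJacobi.IsGeodesic D J X) (hX' : GenJacobi.IsGeodesic D J' X')
    (hrep : GenJacobi.IsReparametrization J X J' X')
    (F : GenJacobi.FermiCoordinates D J X) (F' : GenJacobi.FermiCoordinates D J' X')
    (hPi : F.hyperplane = F'.hyperplane) :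
    -- the connected component of the common domain that contains the central geodesic
    let W : Set M := connectedComponentIn (F.chart.source ∩ F'.chart.source) (X F.s₀)
    (∀ s ∈ J, X s ∈ W) ∧
    ∃ (A B : ℝ) (T : Matrix (Fin m) (Fin m) ℝ), A ≠ 0 ∧ IsUnit T ∧
      (∀ q ∈ W, F'.chart q = GenJacobi.fermiAffine A B T (F.chart q)) ∧
      (∀ q ∈ F.chart.source, GenJacobi.fermiAffine A B T (F.chart q) ∈ F'.chart.target →
        q ∈ F'.chart.source ∧ F'.chart q = GenJacobi.fermiAffine A B T (F.chart q)) ∧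
      -- along geodesics in the region where the coordinates are so related, the components
      -- `ξ^μ ↦ (∂x'^μ/∂x^ν) ξ^ν` of the generalized Jacobi equation transform as a vector
      (∀ (K : Set ℝ) (Y : ℝ → M), GenJacobi.IsGeodesic D K Y →
        (∀ s ∈ K, Y s ∈ F.chart.source ∧
          GenJacobi.fermiAffine A B T (F.chart (Y s)) ∈ F'.chart.target) →
        ∀ ξ ξ' : ℝ → GenJacobi.Coord m,
          (∀ s ∈ K, ξ' s = fderiv ℝ (F'.chart ∘ F.chart.symm) (F.chart (Y s)) (ξ s)) →
          (ContDiffOn ℝ 2 ξ K → ∀ s ∈ K,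
            GenJacobi.genJacobiOp D F'.chart Y ξ' s =
              fderiv ℝ (F'.chart ∘ F.chart.symm) (F.chart (Y s))
                (GenJacobi.genJacobiOp D F.chart Y ξ s)) ∧
          (GenJacobi.IsGenJacobiField D F.chart K Y ξ ↔
            GenJacobi.IsGenJacobiField D F'.chart K Y ξ')) := by
  have : CovariantDerivative.ContMDiffCovariantDerivative D ((⊤ + 1 : ℕ∞) : ℕ∞ω) := by
    simpa only [top_add]
  obtain ⟨hXW, A, B, T, hA, hT, hW, hR, hjac⟩ :=
    mainTheorem3_general D ⊤ J J' X X' hX hX' hrep.image_subset F F' hPi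
  exact ⟨hXW, A, B, T, hA, hT, hW, hR, fun K Y hY =>
    hjac K Y hY.interval.isOpen (hY.solves.smooth.mdifferentiableOn (by simp))⟩
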